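/- Let $n\ge 1$ and let $B_n$ be the Boolean graph: its vertices are the subsets of $[n]=\{1,\dots,n\}$ other than $\emptyset$ and $[n]$, and $M,N$ are adjacent if and only if $M\cap N=\emptyset$. Let $G$ be either $B_n$ or its complement graph $\overline{B_n}$, and let $\Delta$ be the clique complex of the complement graph $\overline{G}$ (the empty set is a face of every complex). For an integer $s\ge 0$ let $\Delta^{(0,s)}$ be the skeleton consisting of all faces $F$ of $\Delta$ with $|F|\le s+1$, and let $\Delta^{(s,s)}$ be the pure skeleton generated by all faces $F$ of $\Delta$ with $|F|=s+1$ (read as $\{\emptyset\}$ if there are none). Then: (1) For every $s\ge 0$ the complex $\Delta^{(0,s)}$ is vertex decomposable. Here a complex $\Gamma$ is called vertex decomposable if it is a simplex (possibly $\{\emptyset\}$), or if, recursively, it has a vertex $x$ such that both $\Gamma\setminus x=\{F\in\Gamma\mid x\notin F\}$ and $\mathrm{lk}_\Gamma(x)=\{F\in\Gamma\mid x\notin F,\ F\cup\{x\}\in\Gamma\}$ are vertex decomposable and no facet of $\mathrm{lk}_\Gamma(x)$ is a facet of $\Gamma\setminus x$. (2) For every $s\ge 0$ the complex $\Delta^{(s,s)}$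 is pure (all its facets have the same cardinality) and shellable, that is, its facets can be ordered $F_1,\dots,F_t$ so that for all $1\le i<k\le t$ there are $1\le j<k$ and $x\in F_k$ with $F_i\cap F_k\subseteq F_j\cap F_k=F_k\setminus\{x\}$; and it is Cohen–Macaulay over every field $K$, that is, the depth of its Stanley–Reisner ring over $K$ (with respect to the graded maximal ideal) equals the Krull dimension of that ring. -/

import Mathlib

/-- A simplicial complex on vertices taken from `V`: a family of finite subsets of `V` that is
closed under taking subsets and contains the empty face. Points of `V` need not be vertices, so
that deletions, links and pure skeletons are complexes over the same `V`. (Mathlib's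
`PreAbstractSimplicialComplex` leaves out the empty face, which can be a facet here.) -/
@[ext]
structure FaceComplex (V : Type*) where
  faces : Set (Finset V)
  empty_mem : ∅ ∈ faces
  down_closed : ∀ ⦃F G : Finset V⦄, F ∈ faces → G ⊆ F → G ∈ faces

namespace FaceComplex

variable {V : Type*}

/-- A facet is a face that is maximal under inclusion. -/
def IsFacet (Δ : FaceComplex V) (F : Finset V) : Prop :=
  Maximal (fun A => A ∈ Δ.faces) F

/-- The simplex of all subsets of `F`; for `F = ∅` this is `{∅}`. -/
def simplex (F : Finset V) : FaceComplex V where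
  faces := {A | A ⊆ F}
  empty_mem := Finset.empty_subset F
  down_closed := fun _ _ hA hB => hB.trans hA

/-- The subcomplex generated by a family of sets; it is `{∅}` for the empty family. -/
def generate (S : Set (Finset V)) : FaceComplex V where
  faces := {A | A = ∅ ∨ ∃ F ∈ S, A ⊆ F}
  empty_mem := Or.inl rfl
  down_closed := by
    rintro A B (rfl | ⟨F, hF, hAF⟩) hBA
    · exact Or.inl (Finset.subset_empty.mp hBA)
    · exact Or.inr ⟨F, hF, hBA.trans hAF⟩

/-- The deletion `Δ \ x`, the faces that do not contain `x`. -/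
def deletion (Δ : FaceComplex V) (x : V) : FaceComplex V where
  faces := {F | F ∈ Δ.faces ∧ x ∉ F}
  empty_mem := ⟨Δ.empty_mem, Finset.notMem_empty x⟩
  down_closed := fun _ _ hF hG => ⟨Δ.down_closed hF.1 hG, fun h => hF.2 (hG h)⟩

/-- The link of a vertex `x`: the faces `F` with `x ∉ F` and `F ∪ {x} ∈ Δ`. -/
def link [DecidableEq V] (Δ : FaceComplex V) (x : V) (hx : {x} ∈ Δ.faces) : FaceComplex V where
  faces := {F | F ∈ Δ.faces ∧ x ∉ F ∧ insert x F ∈ Δ.faces}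
  empty_mem := ⟨Δ.empty_mem, Finset.notMem_empty x, by simpa using hx⟩
  down_closed := fun _ _ hF hG => ⟨Δ.down_closed hF.1 hG, fun h => hF.2.1 (hG h),
    Δ.down_closed hF.2.2 (Finset.insert_subset_insert x hG)⟩

/-- (Nonpure) vertex decomposability. -/
inductive IsVertexDecomposable [DecidableEq V] : FaceComplex V → Prop
  | simplex (F : Finset V) : IsVertexDecomposable (FaceComplex.simplex F)
  | shed (Δ : FaceComplex V) (x : V) (hx : {x} ∈ Δ.faces)
      (hdel : IsVertexDecomposable (Δ.deletion x))
      (hlink : IsVertexDecomposable (Δ.link x hx))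
      (hshed : ∀ F, (Δ.link x hx).IsFacet F → ¬ (Δ.deletion x).IsFacet F) :
      IsVertexDecomposable Δ

/-- The skeleton `Δ^(0,s)`: all faces with at most `s + 1` elements. -/
def skeleton (Δ : FaceComplex V) (s : ℕ) : FaceComplex V where
  faces := {F | F ∈ Δ.faces ∧ F.card ≤ s + 1}
  empty_mem := ⟨Δ.empty_mem, by simp⟩
  down_closed := fun _ _ hF hG =>
    ⟨Δ.down_closed hF.1 hG, (Finset.card_le_card hG).trans hF.2⟩

/-- The pure skeleton `Δ^(s,s)`: generated by the faces of dimension `s`, that is, those with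
exactly `s + 1` elements. -/
def pureSkeleton (Δ : FaceComplex V) (s : ℕ) : FaceComplex V :=
  generate {F | F ∈ Δ.faces ∧ F.card = s + 1}

/-- All facets have the same dimension. -/
def IsPure (Δ : FaceComplex V) : Prop :=
  ∀ ⦃F G : Finset V⦄, Δ.IsFacet F → Δ.IsFacet G → F.card = G.card

/-- (Nonpure) shellability: the facets can be listed without repetition as `F 0, …, F (t - 1)` so
that for `i < k` there are `j < k` and `x ∈ F k` with `F i ∩ F k ⊆ F j ∩ F k = F k \ {x}`. -/
def IsShellable [DecidableEq V] (Δ : FaceComplex V) : Prop :=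
  ∃ (t : ℕ) (F : Fin t → Finset V), Function.Injective F ∧
    (∀ A, Δ.IsFacet A ↔ ∃ i, F i = A) ∧
    ∀ i k : Fin t, i < k → ∃ j < k, ∃ x ∈ F k,
      F i ∩ F k ⊆ F j ∩ F k ∧ F j ∩ F k = (F k).erase x

section StanleyReisner

variable (k : Type*) [Field k]

/-- The Stanley-Reisner ideal, generated by the squarefree monomials of the non-faces. -/
noncomputable def stanleyReisnerIdeal (Δ : FaceComplex V) : Ideal (MvPolynomial V k) :=
  Ideal.span {m | ∃ F : Finset V, F ∉ Δ.faces ∧ m = ∏ v ∈ F, MvPolynomial.X v}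

/-- The Stanley-Reisner ring `k[Δ]`. -/
abbrev StanleyReisnerRing (Δ : FaceComplex V) : Type _ :=
  MvPolynomial V k ⧸ Δ.stanleyReisnerIdeal k

/-- The graded maximal ideal of `k[Δ]`, generated by the classes of the variables. -/
noncomputable def irrelevantIdeal (Δ : FaceComplex V) : Ideal (Δ.StanleyReisnerRing k) :=
  Ideal.span (Set.range fun v : V =>
    Ideal.Quotient.mk (Δ.stanleyReisnerIdeal k) (MvPolynomial.X v))

/-- The depth of `k[Δ]`: the supremum of the lengths of the regular sequences of `k[Δ]` that are
contained in its graded maximal ideal. -/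
noncomputable def depth (Δ : FaceComplex V) : ℕ∞ :=
  ⨆ (rs : List (Δ.StanleyReisnerRing k))
    (_ : (∀ r ∈ rs, r ∈ Δ.irrelevantIdeal k) ∧
      RingTheory.Sequence.IsRegular (Δ.StanleyReisnerRing k) rs), (rs.length : ℕ∞)

/-- `Δ` is Cohen-Macaulay over `k`: the standard graded algebra `k[Δ]` is Cohen-Macaulay, that is,
its depth equals its Krull dimension. -/
def IsCohenMacaulay (Δ : FaceComplex V) : Prop :=
  (Δ.depth k : WithBot ℕ∞) = ringKrullDim (Δ.StanleyReisnerRing k)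

end StanleyReisner

end FaceComplex

/-- The clique complex of a graph. -/
def cliqueComplex {V : Type*} (H : SimpleGraph V) : FaceComplex V where
  faces := {F | H.IsClique (F : Set V)}
  empty_mem := by simp
  down_closed := fun _ _ hF hG => Set.Pairwise.mono (Finset.coe_subset.mpr hG) hF

/-- The vertices of the Boolean graph: the nonempty proper subsets of an `n`-element set. -/
abbrev BooleanVertex (n : ℕ) : Type :=
  {A : Finset (Fin n) // A ≠ ∅ ∧ A ≠ Finset.univ}

/-- The Boolean graph `B_n`: two vertices are adjacent if and only if they are disjoint. -/
def booleanGraph (n : ℕ) : SimpleGraph (BooleanVertex n) where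
  Adj A B := A.1 ∩ B.1 = ∅
  symm := ⟨fun A B h => by rwa [Finset.inter_comm]⟩
  loopless := ⟨fun A h => A.2.1 (by simpa using h)⟩

/-!
In a clique complex a vertex `x` is shedding as soon as it is dominated: some `y` not adjacent to
`x` is adjacent to all neighbours of `x`. For the Boolean graph a set with at least two elements is
dominated by any singleton inside it; for the complementary graph a minimal set disjoint from some
other set of the family is dominated by its complement. Hence both clique complexes are vertex
decomposable. A shedding vertex remains one in the skeletons `Δ^(r,s)` of Björner and Wachs, so
these are vertex decomposable too, and listing the facets of the deletion before those containing
the shedding vertex gives a shelling.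

For the Cohen-Macaulay property let `F 0, …, F t` be a shelling of a pure complex, with facets of
size `m`. The elementary symmetric polynomials `e m, …, e 1` of all variables form a regular
sequence on its Stanley-Reisner ring. They restrict to those of the variables in `F t`, which form a
regular sequence on the polynomial ring `k[simplex (F t)]`. With `R` the least new face contributed
by `F t` and `x_R` its monomial there is an exact sequence
`0 → k[simplex (F t)] → k[F 0, …, F t] → k[F 0, …, F (t - 1)] → 0`
whose first map is multiplication by `x_R`, and induction on `t` applies. As the dimension is at
most `m` and the depth never exceeds the dimension, both are `m`.
-/

section RegularSequences

open RingTheory.Sequence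
open scoped Pointwise

section Module

variable {R M M₁ M₂ M₃ : Type*} [CommRing R] [AddCommGroup M] [Module R M]
  [AddCommGroup M₁] [Module R M₁] [AddCommGroup M₂] [Module R M₂] [AddCommGroup M₃] [Module R M₃]

theorem isWeaklyRegular_of_exact {f : M₁ →ₗ[R] M₂} {g : M₂ →ₗ[R] M₃}
    (hf : Function.Injective f) (hfg : Function.Exact f g) (hg : Function.Surjective g)
    {rs : List R} (h₁ : IsWeaklyRegular M₁ rs) (h₃ : IsWeaklyRegular M₃ rs) :
    IsWeaklyRegular M₂ rs := by
  induction h₁ generalizing M₂ M₃ with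
  | nil => exact .nil R M₂
  | @cons M₁ _ _ r rs hr _ ih =>
    rw [isWeaklyRegular_cons_iff] at h₃
    refine .cons (isSMulRegular_of_range_eq_ker hf hfg.linearMap_ker_eq.symm hr h₃.1) ?_
    refine ih ?_ (QuotSMulTop.map_exact r hfg hg) (QuotSMulTop.map_surjective r hg) h₃.2
    have hzero : Function.Exact (0 : M₁ →ₗ[R] M₁) f := (f.exact_zero_iff_injective M₁).mpr hf
    have hmap := QuotSMulTop.map_first_exact_on_four_term_exact_of_isSMulRegular_last hzero hfg h₃.1
    rwa [map_zero, LinearMap.exact_zero_iff_injective] at hmap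

theorem length_le_supportDim_of_isRegular [IsNoetherianRing R] [Module.Finite R M] {rs : List R}
    (h : IsRegular M rs) : (rs.length : WithBot ℕ∞) ≤ Module.supportDim R M := by
  induction rs generalizing M with
  | nil =>
    have := h.nontrivial
    obtain ⟨d, hd⟩ := WithBot.ne_bot_iff_exists.mp (Module.supportDim_ne_bot_of_nontrivial R M)
    rw [← hd]
    exact WithBot.coe_le_coe.mpr zero_le
  | cons r rs ih =>
    obtain ⟨hr, hrs⟩ := (isRegular_cons_iff M r rs).mp h
    specialize ih hrs
    calc ((r :: rs).length : WithBot ℕ∞) = rs.length + 1 := by simp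
      _ ≤ Module.supportDim R (QuotSMulTop r _) + 1 := by gcongr
      _ ≤ _ := Module.supportDim_quotSMulTop_succ_le_of_notMem_minimalPrimes
        fun _ => hr.notMem_of_mem_minimalPrimes

end Module

section Ideal

open Ideal

variable {R : Type*} [CommRing R] {I J K : Ideal R} {r s x : R} {rs ss : List R}

theorem mem_sup_span_singleton_iff_sub_mem {p : R} :
    p ∈ J ⊔ span {x} ↔ ∃ t, p - x * t ∈ J := by
  rw [sup_comm, mem_span_singleton_sup]
  constructor
  · rintro ⟨t, j, hj, rfl⟩
    exact ⟨t, by convert hj using 1; ring⟩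
  · rintro ⟨t, ht⟩
    exact ⟨t, _, ht, by ring⟩

theorem sup_span_singleton_congr (h : r - s ∈ J) : J ⊔ span {r} = J ⊔ span {s} := by
  apply le_antisymm <;> refine sup_le le_sup_left ((span_singleton_le_iff_mem _).mpr ?_)
  · exact mem_sup_span_singleton_iff_sub_mem.mpr ⟨1, by simpa using h⟩
  · exact mem_sup_span_singleton_iff_sub_mem.mpr ⟨1, by simpa using neg_mem h⟩

theorem isSMulRegular_quotient_congr (h : r - s ∈ J) :
    IsSMulRegular (R ⧸ J) r ↔ IsSMulRegular (R ⧸ J) s := by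
  simp only [isSMulRegular_quotient_iff_mem_of_smul_mem, smul_eq_mul]
  refine forall_congr' fun p => imp_congr_left ?_
  have hp : r * p - s * p ∈ J := sub_mul r s p ▸ J.mul_mem_right p h
  exact ⟨fun hr => by simpa using sub_mem hr hp, fun hs => by simpa using add_mem hs hp⟩

theorem isWeaklyRegular_quotient_cons_iff :
    IsWeaklyRegular (R ⧸ J) (r :: rs) ↔
      IsSMulRegular (R ⧸ J) r ∧ IsWeaklyRegular (R ⧸ (J ⊔ span {r})) rs := by
  rw [isWeaklyRegular_cons_iff]
  refine and_congr_right fun _ => LinearEquiv.isWeaklyRegular_congr ?_ rs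
  refine Submodule.quotEquivOfEq _ _ ?_ ≪≫ₗ
    Submodule.quotientQuotientEquivQuotientSup (J : Submodule R R) (span {r})
  have hr : span {r} = r • (⊤ : Submodule R R) := by
    rw [← Submodule.ideal_span_singleton_smul]
    exact (Ideal.mul_top _).symm
  rw [hr, Submodule.map_pointwise_smul, Submodule.map_top, Submodule.range_mkQ]

theorem isWeaklyRegular_quotient_congr (h : List.Forall₂ (fun r s => r - s ∈ J) rs ss)
    (hrs : IsWeaklyRegular (R ⧸ J) rs) : IsWeaklyRegular (R ⧸ J) ss := by
  induction rs generalizing J ss with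
  | nil => rwa [List.forall₂_nil_left_iff.mp h]
  | cons r rs ih =>
    obtain ⟨s, ss, hr, hss, rfl⟩ := List.forall₂_cons_left_iff.mp h
    rw [isWeaklyRegular_quotient_cons_iff] at hrs ⊢
    rw [← sup_span_singleton_congr hr, ← isSMulRegular_quotient_congr hr]
    exact ⟨hrs.1, ih (hss.imp fun _ _ h => mem_sup_left h) hrs.2⟩

/-- The exact sequence `0 → R/(I : x) → R/I → R/(I, x) → 0` behind an induction on ideals. -/
theorem isWeaklyRegular_quotient_of_colon (hK : ∀ p, x * p ∈ I ↔ p ∈ K)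
    (h₁ : IsWeaklyRegular (R ⧸ K) rs) (h₂ : IsWeaklyRegular (R ⧸ (I ⊔ span {x})) rs) :
    IsWeaklyRegular (R ⧸ I) rs := by
  let f : R ⧸ K →ₗ[R] R ⧸ I := Submodule.mapQ K I (LinearMap.mulLeft R x) fun p hp => (hK p).mpr hp
  let g : R ⧸ I →ₗ[R] R ⧸ (I ⊔ span {x}) := Submodule.factor le_sup_left
  refine isWeaklyRegular_of_exact (f := f) (g := g) ?_ ?_ (Submodule.factor_surjective _) h₁ h₂
  · refine (injective_iff_map_eq_zero f).mpr fun q hq => ?_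
    obtain ⟨p, rfl⟩ := Submodule.Quotient.mk_surjective K q
    exact (Submodule.Quotient.mk_eq_zero K).mpr
      ((hK p).mp ((Submodule.Quotient.mk_eq_zero I).mp hq))
  · refine fun q => ?_
    obtain ⟨p, rfl⟩ := Submodule.Quotient.mk_surjective I q
    calc g (Submodule.Quotient.mk p) = 0 ↔ p ∈ I ⊔ span {x} := Submodule.Quotient.mk_eq_zero _
      _ ↔ ∃ t, p - x * t ∈ I := mem_sup_span_singleton_iff_sub_mem
      _ ↔ ∃ q, f q = Submodule.Quotient.mk p := by
        rw [(Submodule.Quotient.mk_surjective K).exists]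
        refine exists_congr fun t => ?_
        rw [eq_comm]
        exact (Submodule.Quotient.eq I).symm

/-- The list `a m, a (m - 1), …, a 1`. Elementary symmetric polynomials are arranged in this order,
highest degree first, to form a regular sequence. -/
def descending {α : Type*} (a : ℕ → α) (m : ℕ) : List α :=
  (List.range m).reverse.map fun i => a (i + 1)

theorem descending_succ {α : Type*} (a : ℕ → α) (m : ℕ) :
    descending a (m + 1) = a (m + 1) :: descending a m := by
  simp [descending, List.range_succ]

theorem length_descending {α : Type*} (a : ℕ → α) (m : ℕ) : (descending a m).length = m := by
  simp [descending]

theorem forall₂_descending {α β : Type*} {P : α → β → Prop} {a : ℕ → α} {b : ℕ → β} {m : ℕ}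
    (h : ∀ i < m, P (a (i + 1)) (b (i + 1))) :
    List.Forall₂ P (descending a m) (descending b m) := by
  simpa [descending, List.forall₂_map_left_iff, List.forall₂_map_right_iff, List.forall₂_same]
    using h

theorem mem_descending {α : Type*} {a : ℕ → α} {m : ℕ} {r : α} :
    r ∈ descending a m ↔ ∃ i < m, a (i + 1) = r := by
  simp [descending]

theorem mul_mem_sup_span_mul_iff (hx : IsSMulRegular (R ⧸ J) x) {p : R} :
    x * p ∈ J ⊔ span {x * r} ↔ p ∈ J ⊔ span {r} := by
  simp only [mem_sup_span_singleton_iff_sub_mem]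
  refine exists_congr fun t => ?_
  rw [mul_assoc, ← mul_sub]
  exact ⟨mem_of_isSMulRegular_quotient_of_smul_mem hx, J.mul_mem_left x⟩

theorem isSMulRegular_quotient_sup_span (hx : IsSMulRegular (R ⧸ J) x)
    (hr : IsSMulRegular (R ⧸ (J ⊔ span {x})) r) : IsSMulRegular (R ⧸ (J ⊔ span {r})) x := by
  rw [isSMulRegular_quotient_iff_mem_of_smul_mem]
  intro p hp
  obtain ⟨t, ht⟩ := mem_sup_span_singleton_iff_sub_mem.mp hp
  have hrt : r • t ∈ J ⊔ span {x} :=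
    mem_sup_span_singleton_iff_sub_mem.mpr ⟨p, by simpa using neg_mem ht⟩
  obtain ⟨u, hu⟩ := mem_sup_span_singleton_iff_sub_mem.mp
    (mem_of_isSMulRegular_quotient_of_smul_mem hr hrt)
  refine mem_sup_span_singleton_iff_sub_mem.mpr
    ⟨u, mem_of_isSMulRegular_quotient_of_smul_mem hx ?_⟩
  convert add_mem ht (J.mul_mem_left r hu) using 1
  rw [smul_eq_mul, smul_eq_mul]
  ring

/-- If `a` lists the coefficients of a polynomial in `t`, then `b` lists those of its product with
`1 + x t`. -/
theorem isWeaklyRegular_quotient_mul_linear {a b : ℕ → R} (ha : a 0 = 1)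
    (hb : ∀ i, b (i + 1) = a (i + 1) + x * a i) {m : ℕ} (hx : IsSMulRegular (R ⧸ J) x)
    (h₁ : IsWeaklyRegular (R ⧸ J) (descending a m))
    (h₂ : IsWeaklyRegular (R ⧸ (J ⊔ span {x})) (descending a m)) :
    IsWeaklyRegular (R ⧸ J) (x * a m :: descending b m) := by
  induction m generalizing J with
  | zero =>
    rw [isWeaklyRegular_quotient_cons_iff, ha, mul_one]
    exact ⟨hx, .nil R _⟩
  | succ m ih =>
    have hb' : List.Forall₂ (fun r s => r - s ∈ J ⊔ span {x})
        (descending a (m + 1)) (descending b (m + 1)) := forall₂_descending fun i _ => by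
      rw [hb, sub_add_cancel_left]
      exact neg_mem (mem_sup_right (mul_mem_right _ _ (mem_span_singleton_self x)))
    have hbtop := h₂
    rw [descending_succ, isWeaklyRegular_quotient_cons_iff] at h₁ h₂
    rw [isWeaklyRegular_quotient_cons_iff]
    refine ⟨hx.mul h₁.1, isWeaklyRegular_quotient_of_colon
      (fun p => mul_mem_sup_span_mul_iff hx) (rs := descending b (m + 1)) ?_ ?_⟩
    · refine isWeaklyRegular_quotient_congr ?_ (ih (isSMulRegular_quotient_sup_span hx h₂.1) h₁.2
        (sup_right_comm J (span {x}) _ ▸ h₂.2))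
      rw [descending_succ, hb]
      refine .cons ?_ (List.forall₂_same.mpr fun r _ => by simp)
      rw [sub_add_cancel_right]
      exact neg_mem (mem_sup_right (mem_span_singleton_self _))
    · have hsup : J ⊔ span {x * a (m + 1)} ⊔ span {x} = J ⊔ span {x} := by
        rw [sup_assoc, sup_eq_right (a := span {x * a (m + 1)}).mpr
          (span_singleton_le_span_singleton.mpr (Dvd.intro _ rfl))]
      rw [hsup]
      exact isWeaklyRegular_quotient_congr hb' hbtop

theorem esymm_cons (x : R) (s : Multiset R) (i : ℕ) :
    (x ::ₘ s).esymm (i + 1) = s.esymm (i + 1) + x * s.esymm i := by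
  simp [Multiset.esymm, Multiset.powersetCard_cons, Multiset.sum_map_mul_left]

theorem esymm_eq_zero_of_card_lt {s : Multiset R} {i : ℕ} (h : s.card < i) : s.esymm i = 0 := by
  simp [Multiset.esymm, Multiset.powersetCard_eq_empty i h]

theorem isWeaklyRegular_quotient_esymm {ι : Type*} [DecidableEq ι] {f : ι → R} {s : Finset ι}
    (h : ∀ t ⊆ s, ∀ x ∈ s \ t, IsSMulRegular (R ⧸ (J ⊔ span (f '' t))) (f x)) :
    IsWeaklyRegular (R ⧸ J) (descending (s.val.map f).esymm s.card) := by
  induction s using Finset.induction_on generalizing J with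
  | empty => exact .nil R _
  | insert x s hx ih =>
    have hreg : IsSMulRegular (R ⧸ J) (f x) := by
      have hJ : J ⊔ span (f '' (∅ : Finset ι)) = J := by simp
      exact hJ ▸ h ∅ (by simp) x (by simp)
    have hs : IsWeaklyRegular (R ⧸ J) (descending (s.val.map f).esymm s.card) :=
      ih fun t ht y hy => h t (ht.trans (s.subset_insert x)) y (by grind)
    have hs' : IsWeaklyRegular (R ⧸ (J ⊔ span {f x}))
        (descending (s.val.map f).esymm s.card) := by
      refine ih fun t ht y hy => ?_
      have hsup : J ⊔ span {f x} ⊔ span (f '' t) = J ⊔ span (f '' ↑(insert x t)) := by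
        rw [sup_assoc, ← span_union, Finset.coe_insert, Set.image_insert_eq, Set.singleton_union]
      rw [hsup]
      exact h (insert x t) (Finset.insert_subset_insert x ht) y (by grind)
    have htop : (s.val.map f).esymm (s.card + 1) = 0 := esymm_eq_zero_of_card_lt (by simp)
    rw [Finset.insert_val_of_notMem hx, Multiset.map_cons, Finset.card_insert_of_notMem hx,
      descending_succ, esymm_cons, htop, zero_add]
    exact isWeaklyRegular_quotient_mul_linear (by simp [Multiset.esymm]) (esymm_cons _ _)
      hreg hs hs'

theorem ringKrullDim_quotient_le_of_forall_isPrime {d : WithBot ℕ∞}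
    (h : ∀ P : Ideal R, P.IsPrime → I ≤ P → ∃ J ≤ P, ringKrullDim (R ⧸ J) ≤ d) :
    ringKrullDim (R ⧸ I) ≤ d := by
  rw [ringKrullDim_quotient]
  refine iSup_le fun c => ?_
  obtain ⟨J, hJ, hd⟩ := h c.head.1.asIdeal c.head.1.isPrime c.head.2
  rw [ringKrullDim_quotient] at hd
  let c' : LTSeries (PrimeSpectrum.zeroLocus (J : Set R)) :=
    { length := c.length
      toFun := fun i => ⟨(c i).1, hJ.trans (c.head_le i)⟩
      step := fun i => c.step i }
  exact (le_iSup (fun c : LTSeries (PrimeSpectrum.zeroLocus (J : Set R)) =>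
    ((c.length : ℕ∞) : WithBot ℕ∞)) c').trans hd

end Ideal

end RegularSequences

namespace FaceComplex

variable {V : Type*}

section Skeleta

theorem mem_faces_simplex {A F : Finset V} : A ∈ (simplex F).faces ↔ A ⊆ F :=
  Iff.rfl

theorem mem_of_isFacet_generate {𝓕 : Set (Finset V)} (hne : 𝓕.Nonempty) {A : Finset V}
    (hA : (generate 𝓕).IsFacet A) : A ∈ 𝓕 := by
  obtain ⟨F, hF, hAF⟩ : ∃ F ∈ 𝓕, A ⊆ F := by
    rcases hA.1 with rfl | h
    exacts [hne.imp fun F hF => ⟨hF, F.empty_subset⟩, h]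
  rwa [hAF.antisymm (hA.2 (Or.inr ⟨F, hF, subset_rfl⟩) hAF)]

theorem isPure_generate {𝓕 : Set (Finset V)} {m : ℕ} (hcard : ∀ F ∈ 𝓕, F.card = m) :
    (generate 𝓕).IsPure := by
  intro A B hA hB
  rcases 𝓕.eq_empty_or_nonempty with rfl | hne
  · have eq_empty : ∀ C ∈ (generate (∅ : Set (Finset V))).faces, C = ∅ := by simp [generate]
    rw [eq_empty A hA.1, eq_empty B hB.1]
  · rw [hcard A (mem_of_isFacet_generate hne hA), hcard B (mem_of_isFacet_generate hne hB)]

theorem isPure_pureSkeleton (Δ : FaceComplex V) (s : ℕ) : (Δ.pureSkeleton s).IsPure :=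
  isPure_generate fun _ hF => hF.2

/-- The skeleton `Δ^(r,s)` of Björner and Wachs, generated by the faces whose dimension lies
between `r` and `s`. Here `r` and `s` bound cardinalities instead of dimensions. -/
def skeletonBetween (Δ : FaceComplex V) (r s : ℕ) : FaceComplex V :=
  generate {F | F ∈ Δ.faces ∧ r ≤ F.card ∧ F.card ≤ s}

theorem skeletonBetween_zero_succ (Δ : FaceComplex V) (s : ℕ) :
    Δ.skeletonBetween 0 (s + 1) = Δ.skeleton s := by
  ext A
  constructor
  · rintro (rfl | ⟨F, ⟨hF, -, hFs⟩, hAF⟩)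
    · exact (Δ.skeleton s).empty_mem
    · exact (Δ.skeleton s).down_closed ⟨hF, hFs⟩ hAF
  · exact fun hA => Or.inr ⟨A, ⟨hA.1, A.card.zero_le, hA.2⟩, subset_rfl⟩

theorem skeletonBetween_self_succ (Δ : FaceComplex V) (s : ℕ) :
    Δ.skeletonBetween (s + 1) (s + 1) = Δ.pureSkeleton s := by
  simp only [skeletonBetween, pureSkeleton, le_antisymm_iff, and_comm]

theorem skeletonBetween_eq_simplex_empty {Δ : FaceComplex V} {r s : ℕ}
    (h : ∀ F ∈ Δ.faces, r ≤ F.card → F.card ≤ s → F = ∅) :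
    Δ.skeletonBetween r s = simplex ∅ := by
  ext A
  constructor
  · rintro (rfl | ⟨F, ⟨hF, hrF, hFs⟩, hAF⟩)
    · exact Finset.empty_subset ∅
    · exact hAF.trans (h F hF hrF hFs).subset
  · exact fun hA => Or.inl (Finset.subset_empty.mp hA)

theorem skeletonBetween_zero_right (Δ : FaceComplex V) (r : ℕ) :
    Δ.skeletonBetween r 0 = simplex ∅ :=
  skeletonBetween_eq_simplex_empty fun _ _ _ h => Finset.card_eq_zero.mp (Nat.le_zero.mp h)

theorem skeletonBetween_simplex {F : Finset V} {r s : ℕ} (hr : r ≤ F.card) (hs : F.card ≤ s) :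
    (simplex F).skeletonBetween r s = simplex F := by
  ext A
  constructor
  · rintro (rfl | ⟨B, ⟨hB, -, -⟩, hAB⟩)
    exacts [F.empty_subset, hAB.trans hB]
  · exact fun hA => Or.inr ⟨F, ⟨mem_faces_simplex.mpr subset_rfl, hr, hs⟩, hA⟩

theorem deletion_eq_self {Δ : FaceComplex V} {x : V} (hx : {x} ∉ Δ.faces) :
    Δ.deletion x = Δ := by
  ext A
  exact ⟨And.left, fun hA =>
    ⟨hA, fun hxA => hx (Δ.down_closed hA (Finset.singleton_subset_iff.mpr hxA))⟩⟩

variable [DecidableEq V]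

theorem not_isFacet_of_insert_mem {Δ : FaceComplex V} {A : Finset V} {y : V} (hy : y ∉ A)
    (h : insert y A ∈ Δ.faces) : ¬ Δ.IsFacet A :=
  fun hA => hy (hA.2 h (A.subset_insert y) (A.mem_insert_self y))

theorem exists_insert_mem_of_not_isFacet {Δ : FaceComplex V} {A : Finset V} (hA : A ∈ Δ.faces)
    (h : ¬ Δ.IsFacet A) : ∃ y ∉ A, insert y A ∈ Δ.faces := by
  contrapose! h
  refine ⟨hA, fun B hB hAB y hy => ?_⟩
  by_contra hyA
  exact h y hyA (Δ.down_closed hB (Finset.insert_subset hy hAB))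

theorem exists_insert_mem_deletion_of_mem_link {Δ : FaceComplex V} {x : V} {hx : {x} ∈ Δ.faces}
    (hshed : ∀ F, (Δ.link x hx).IsFacet F → ¬ (Δ.deletion x).IsFacet F) {A : Finset V}
    (hA : A ∈ (Δ.link x hx).faces) : ∃ y ∉ A, insert y A ∈ (Δ.deletion x).faces := by
  have hAdel : A ∈ (Δ.deletion x).faces := ⟨hA.1, hA.2.1⟩
  by_cases hfacet : (Δ.link x hx).IsFacet A
  · exact exists_insert_mem_of_not_isFacet hAdel (hshed A hfacet)
  · obtain ⟨y, hy, hyA⟩ := exists_insert_mem_of_not_isFacet hA hfacet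
    exact ⟨y, hy, hyA.1, hyA.2.1⟩

theorem erase_mem_link {Δ : FaceComplex V} {x : V} (hx : {x} ∈ Δ.faces) {F : Finset V}
    (hF : F ∈ Δ.faces) (hxF : x ∈ F) : F.erase x ∈ (Δ.link x hx).faces :=
  ⟨Δ.down_closed hF (F.erase_subset x), F.notMem_erase x, by rwa [Finset.insert_erase hxF]⟩

theorem deletion_simplex_insert {x : V} {F : Finset V} (hx : x ∉ F) :
    (simplex (insert x F)).deletion x = simplex F := by
  ext A
  exact ⟨fun hA => (Finset.subset_insert_iff_of_notMem hA.2).mp hA.1,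
    fun hA => ⟨hA.trans (F.subset_insert x), fun hxA => hx (hA hxA)⟩⟩

theorem link_simplex_insert {x : V} {F : Finset V} (hx : x ∉ F)
    (hx' : {x} ∈ (simplex (insert x F)).faces) :
    (simplex (insert x F)).link x hx' = simplex F := by
  ext A
  exact ⟨fun hA => (Finset.subset_insert_iff_of_notMem hA.2.1).mp hA.1,
    fun hA => ⟨hA.trans (F.subset_insert x), fun hxA => hx (hA hxA),
      Finset.insert_subset_insert x hA⟩⟩

variable {Δ : FaceComplex V} {x : V} {r s : ℕ}

theorem deletion_skeletonBetween_succ (hx : {x} ∈ Δ.faces)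
    (hext : ∀ A ∈ (Δ.link x hx).faces, A.card ≤ s → ∃ y ∉ A, insert y A ∈ (Δ.deletion x).faces) :
    (Δ.skeletonBetween r (s + 1)).deletion x = (Δ.deletion x).skeletonBetween r (s + 1) := by
  ext A
  constructor
  · rintro ⟨rfl | ⟨F, ⟨hF, hrF, hFs⟩, hAF⟩, hxA⟩
    · exact empty_mem _
    by_cases hxF : x ∈ F
    · have hcard := Finset.card_erase_add_one hxF
      obtain ⟨y, hy, hyF⟩ := hext _ (erase_mem_link hx hF hxF) (by omega)
      rw [← hcard, ← Finset.card_insert_of_notMem hy] at hrF hFs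
      exact Or.inr ⟨_, ⟨hyF, hrF, hFs⟩,
        (Finset.subset_erase.mpr ⟨hAF, hxA⟩).trans (Finset.subset_insert _ _)⟩
    · exact Or.inr ⟨F, ⟨⟨hF, hxF⟩, hrF, hFs⟩, hAF⟩
  · rintro (rfl | ⟨F, ⟨⟨hF, hxF⟩, hrF, hFs⟩, hAF⟩)
    · exact empty_mem _
    · exact ⟨Or.inr ⟨F, ⟨hF, hrF, hFs⟩, hAF⟩, fun hxA => hxF (hAF hxA)⟩

theorem link_skeletonBetween_succ (hx : {x} ∈ Δ.faces)
    (hx' : {x} ∈ (Δ.skeletonBetween r (s + 1)).faces) :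
    (Δ.skeletonBetween r (s + 1)).link x hx' = (Δ.link x hx).skeletonBetween (r - 1) s := by
  ext A
  constructor
  · rintro ⟨-, hxA, h | ⟨F, ⟨hF, hrF, hFs⟩, hAF⟩⟩
    · exact absurd h (Finset.insert_ne_empty x A)
    have hxF : x ∈ F := hAF (A.mem_insert_self x)
    have hcard := Finset.card_erase_add_one hxF
    exact Or.inr ⟨F.erase x, ⟨erase_mem_link hx hF hxF, by omega, by omega⟩,
      Finset.subset_erase.mpr ⟨(A.subset_insert x).trans hAF, hxA⟩⟩
  · rintro (rfl | ⟨L, ⟨⟨-, hxL, hL⟩, hrL, hLs⟩, hAL⟩)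
    · exact empty_mem _
    have hcard := Finset.card_insert_of_notMem hxL
    have hA : insert x A ∈ (Δ.skeletonBetween r (s + 1)).faces :=
      Or.inr ⟨insert x L, ⟨hL, by omega, by omega⟩, Finset.insert_subset_insert x hAL⟩
    exact ⟨down_closed _ hA (A.subset_insert x), fun hxA => hxL (hAL hxA), hA⟩

/-- If every face of the link in the relevant range of cardinalities can be enlarged within the
deletion, then `x` is a shedding vertex of the skeleton, unless it is no vertex there at all. -/
theorem isVertexDecomposable_skeletonBetween_succ (hx : {x} ∈ Δ.faces)
    (hext : ∀ A ∈ (Δ.link x hx).faces, A.card ≤ s → ∃ y ∉ A, insert y A ∈ (Δ.deletion x).faces)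
    (hdel : ((Δ.deletion x).skeletonBetween r (s + 1)).IsVertexDecomposable)
    (hlink : ((Δ.link x hx).skeletonBetween (r - 1) s).IsVertexDecomposable) :
    (Δ.skeletonBetween r (s + 1)).IsVertexDecomposable := by
  rw [← deletion_skeletonBetween_succ hx hext] at hdel
  by_cases hx' : {x} ∈ (Δ.skeletonBetween r (s + 1)).faces
  swap
  · rwa [deletion_eq_self hx'] at hdel
  rw [← link_skeletonBetween_succ hx hx'] at hlink
  refine .shed _ x hx' hdel hlink fun A hA => ?_
  rw [link_skeletonBetween_succ hx hx'] at hA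
  rw [deletion_skeletonBetween_succ hx hext]
  have hne : {L | L ∈ (Δ.link x hx).faces ∧ r - 1 ≤ L.card ∧ L.card ≤ s}.Nonempty := by
    obtain h | ⟨F, ⟨hF, hrF, hFs⟩, hxF⟩ := hx'
    · exact absurd h (Finset.singleton_ne_empty x)
    rw [Finset.singleton_subset_iff] at hxF
    have hcard := Finset.card_erase_add_one hxF
    exact ⟨F.erase x, erase_mem_link hx hF hxF, by omega, by omega⟩
  obtain ⟨hAlink, hrA, hAs⟩ := mem_of_isFacet_generate hne hA
  obtain ⟨y, hy, hyA⟩ := hext A hAlink hAs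
  have hcard := Finset.card_insert_of_notMem hy
  exact not_isFacet_of_insert_mem hy (Or.inr ⟨_, ⟨hyA, by omega, by omega⟩, subset_rfl⟩)

theorem isVertexDecomposable_skeletonBetween_simplex (F : Finset V) (r s : ℕ) :
    ((simplex F).skeletonBetween r s).IsVertexDecomposable := by
  induction F using Finset.induction_on generalizing r s with
  | empty =>
    rw [skeletonBetween_eq_simplex_empty fun _ hF _ _ =>
      Finset.subset_empty.mp (mem_faces_simplex.mp hF)]
    exact .simplex ∅
  | insert x F hxF ih =>
    obtain _ | s := s
    · rw [skeletonBetween_zero_right]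
      exact .simplex ∅
    by_cases hrs : r ≤ (insert x F).card ∧ (insert x F).card ≤ s + 1
    · rw [skeletonBetween_simplex hrs.1 hrs.2]
      exact .simplex _
    by_cases hr : (insert x F).card < r
    · rw [skeletonBetween_eq_simplex_empty fun A hA hrA _ =>
        absurd (hrA.trans (Finset.card_le_card hA)) hr.not_ge]
      exact .simplex ∅
    have hs : s < F.card := by
      rw [Finset.card_insert_of_notMem hxF] at hrs hr
      omega
    have hx : {x} ∈ (simplex (insert x F)).faces := by simp [simplex]
    refine isVertexDecomposable_skeletonBetween_succ hx (fun A hA hAs => ?_) ?_ ?_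
    · rw [link_simplex_insert hxF] at hA
      obtain ⟨y, hyF, hyA⟩ := Finset.exists_mem_notMem_of_card_lt_card (hAs.trans_lt hs)
      rw [deletion_simplex_insert hxF]
      exact ⟨y, hyA, Finset.insert_subset hyF hA⟩
    · rw [deletion_simplex_insert hxF]
      exact ih r (s + 1)
    · rw [link_simplex_insert hxF]
      exact ih (r - 1) s

theorem IsVertexDecomposable.skeletonBetween (h : Δ.IsVertexDecomposable) (r s : ℕ) :
    (Δ.skeletonBetween r s).IsVertexDecomposable := by
  induction h generalizing r s with
  | simplex F => exact isVertexDecomposable_skeletonBetween_simplex F r s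
  | shed Δ x hx _ _ hshed ihdel ihlink =>
    obtain _ | s := s
    · rw [skeletonBetween_zero_right]
      exact .simplex ∅
    · exact isVertexDecomposable_skeletonBetween_succ hx
        (fun A hA _ => exists_insert_mem_deletion_of_mem_link hshed hA)
        (ihdel r (s + 1)) (ihlink (r - 1) s)

theorem IsVertexDecomposable.skeleton (h : Δ.IsVertexDecomposable) (s : ℕ) :
    (Δ.skeleton s).IsVertexDecomposable :=
  Δ.skeletonBetween_zero_succ s ▸ h.skeletonBetween 0 (s + 1)

theorem IsVertexDecomposable.pureSkeleton (h : Δ.IsVertexDecomposable) (s : ℕ) :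
    (Δ.pureSkeleton s).IsVertexDecomposable :=
  Δ.skeletonBetween_self_succ s ▸ h.skeletonBetween (s + 1) (s + 1)

end Skeleta

section Shelling

theorem isFacet_simplex_iff {A F : Finset V} : (simplex F).IsFacet A ↔ F = A := by
  constructor
  · exact fun h => (h.2 (mem_faces_simplex.mpr subset_rfl) h.1).antisymm h.1
  · rintro rfl
    exact ⟨mem_faces_simplex.mpr subset_rfl, fun _ hB _ => hB⟩

variable [DecidableEq V]

/-- A shelling order: the condition of `IsShellable` on a list of sets, which need not be the
facets of a complex. -/
def IsShelling {t : ℕ} (F : Fin t → Finset V) : Prop :=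
  ∀ i k : Fin t, i < k → ∃ j < k, ∃ x ∈ F k, F i ∩ F k ⊆ F j ∩ F k ∧ F j ∩ F k = (F k).erase x

theorem isShelling_iff {t : ℕ} {F : Fin t → Finset V} :
    IsShelling F ↔
      ∀ i k : Fin t, i < k → ∃ j < k, ∃ x ∈ F k, x ∉ F i ∧ F j ∩ F k = (F k).erase x := by
  refine forall₂_congr fun i k => imp_congr_right fun _ => exists_congr fun j =>
    and_congr_right fun _ => exists_congr fun x => and_congr_right fun hx =>
    and_congr_left fun h => ?_
  rw [h, Finset.subset_erase]
  simp [hx, Finset.inter_subset_right]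

theorem IsShelling.append_insert {t u : ℕ} {D : Fin t → Finset V} {L : Fin u → Finset V} {x : V}
    (hD : IsShelling D) (hL : IsShelling L) (hxD : ∀ i, x ∉ D i) (hxL : ∀ k, x ∉ L k)
    (hLD : ∀ k, ∃ j, L k ⊆ D j) : IsShelling (Fin.append D fun k => insert x (L k)) := by
  rw [isShelling_iff] at hD hL ⊢
  have castAdd_lt_natAdd (i : Fin t) (k : Fin u) : i.castAdd u < k.natAdd t :=
    Fin.lt_def.mpr (i.isLt.trans_le (Nat.le_add_right t k))
  intro i k
  induction k using Fin.addCases with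
  | left k =>
    induction i using Fin.addCases with
    | left i =>
      intro hik
      obtain ⟨j, hjk, y, hy, hyi, hj⟩ := hD i k hik
      exact ⟨j.castAdd u, hjk, y, by simpa using hy, by simpa using hyi, by simpa using hj⟩
    | right i => exact fun hik => absurd hik (castAdd_lt_natAdd k i).asymm
  | right k =>
    induction i using Fin.addCases with
    | left i =>
      obtain ⟨j, hj⟩ := hLD k
      refine fun _ => ⟨j.castAdd u, castAdd_lt_natAdd j k, x, by simp, by simpa using hxD i, ?_⟩
      simpa [Finset.inter_insert_of_notMem (hxD j), Finset.erase_insert (hxL k)] using hj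
    | right i =>
      intro hik
      obtain ⟨j, hjk, y, hy, hyi, hj⟩ := hL i k (by simpa using hik)
      have hyx : x ≠ y := ne_of_mem_of_not_mem hy (hxL k) |>.symm
      refine ⟨j.natAdd t, by simpa using hjk, y, by simp [hy], by simp [hyx.symm, hyi], ?_⟩
      simp only [Fin.append_right, ← Finset.insert_inter_distrib, hj,
        Finset.erase_insert_of_ne hyx]

variable {Δ : FaceComplex V} {x : V}

theorem isFacet_link_iff (hx : {x} ∈ Δ.faces) {L : Finset V} :
    (Δ.link x hx).IsFacet L ↔ x ∉ L ∧ Δ.IsFacet (insert x L) := by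
  constructor
  · refine fun h => ⟨h.1.2.1, h.1.2.2, fun B hB hLB => ?_⟩
    rw [Finset.insert_subset_iff] at hLB
    rw [Finset.subset_insert_iff]
    exact h.2 (erase_mem_link hx hB hLB.1) (Finset.subset_erase.mpr ⟨hLB.2, h.1.2.1⟩)
  · rintro ⟨hxL, h⟩
    refine ⟨⟨Δ.down_closed h.1 (L.subset_insert x), hxL, h.1⟩, fun B hB hLB => ?_⟩
    exact (Finset.subset_insert_iff_of_notMem hB.2.1).mp
      ((B.subset_insert x).trans (h.2 hB.2.2 (Finset.insert_subset_insert x hLB)))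

theorem isFacet_deletion_iff {hx : {x} ∈ Δ.faces}
    (hshed : ∀ F, (Δ.link x hx).IsFacet F → ¬ (Δ.deletion x).IsFacet F) {A : Finset V} :
    (Δ.deletion x).IsFacet A ↔ x ∉ A ∧ Δ.IsFacet A := by
  refine ⟨fun h => ⟨h.1.2, h.1.1, fun B hB hAB => ?_⟩,
    fun ⟨hxA, h⟩ => ⟨⟨h.1, hxA⟩, fun B hB => h.2 hB.1⟩⟩
  by_cases hxB : x ∈ B
  · have hA : A ∈ (Δ.link x hx).faces :=
      down_closed _ (erase_mem_link hx hB hxB) (Finset.subset_erase.mpr ⟨hAB, h.1.2⟩)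
    obtain ⟨y, hy, hyA⟩ := exists_insert_mem_deletion_of_mem_link hshed hA
    exact absurd h (not_isFacet_of_insert_mem hy hyA)
  · exact h.2 ⟨hB, hxB⟩ hAB

theorem IsVertexDecomposable.exists_isFacet_superset (h : Δ.IsVertexDecomposable) {A : Finset V}
    (hA : A ∈ Δ.faces) : ∃ F, Δ.IsFacet F ∧ A ⊆ F := by
  induction h generalizing A with
  | simplex F => exact ⟨F, isFacet_simplex_iff.mpr rfl, hA⟩
  | shed Δ x hx _ _ hshed ihdel ihlink =>
    by_cases hxA : x ∈ A
    · obtain ⟨L, hL, hAL⟩ := ihlink (erase_mem_link hx hA hxA)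
      exact ⟨insert x L, ((isFacet_link_iff hx).mp hL).2,
        Finset.subset_insert_iff.mpr hAL⟩
    · obtain ⟨D, hD, hAD⟩ := ihdel ⟨hA, hxA⟩
      exact ⟨D, ((isFacet_deletion_iff hshed).mp hD).2, hAD⟩

theorem isFacet_iff_exists_append {t u : ℕ} {D : Fin t → Finset V} {L : Fin u → Finset V}
    (hD : ∀ A, x ∉ A ∧ Δ.IsFacet A ↔ ∃ i, D i = A)
    (hL : ∀ A, x ∉ A ∧ Δ.IsFacet (insert x A) ↔ ∃ k, L k = A) {A : Finset V} :
    Δ.IsFacet A ↔ ∃ i, Fin.append D (fun k => insert x (L k)) i = A := by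
  constructor
  · intro hA
    by_cases hxA : x ∈ A
    · obtain ⟨k, hk⟩ := (hL (A.erase x)).mp
        ⟨A.notMem_erase x, by rwa [Finset.insert_erase hxA]⟩
      exact ⟨k.natAdd t, by rw [Fin.append_right, hk, Finset.insert_erase hxA]⟩
    · obtain ⟨i, rfl⟩ := (hD A).mp ⟨hxA, hA⟩
      exact ⟨i.castAdd u, Fin.append_left ..⟩
  · rintro ⟨i, rfl⟩
    induction i using Fin.addCases with
    | left i => simpa only [Fin.append_left] using ((hD (D i)).mpr ⟨i, rfl⟩).2
    | right k => simpa only [Fin.append_right] using ((hL (L k)).mpr ⟨k, rfl⟩).2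

theorem IsVertexDecomposable.isShellable (h : Δ.IsVertexDecomposable) : Δ.IsShellable := by
  induction h with
  | simplex F =>
    exact ⟨1, fun _ => F, Function.injective_of_subsingleton _,
      fun A => isFacet_simplex_iff.trans (by simp),
      fun i k hik => absurd hik (Subsingleton.elim i k).not_lt⟩
  | shed Δ x hx hdel _ hshed ihdel ihlink =>
    obtain ⟨t, D, hDinj, hDfacet, hD⟩ := ihdel
    obtain ⟨u, L, hLinj, hLfacet, hL⟩ := ihlink
    simp only [isFacet_deletion_iff hshed] at hDfacet
    simp only [isFacet_link_iff hx] at hLfacet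
    have hxD i : x ∉ D i := ((hDfacet (D i)).mpr ⟨i, rfl⟩).1
    have hxL k : x ∉ L k := ((hLfacet (L k)).mpr ⟨k, rfl⟩).1
    refine ⟨t + u, _, ?_, fun A => isFacet_iff_exists_append hDfacet hLfacet,
      IsShelling.append_insert hD hL hxD hxL fun k => ?_⟩
    · refine Fin.append_injective_iff.mpr ⟨hDinj, fun k l hkl => hLinj ?_, fun i k hik => ?_⟩
      · have hkl : insert x (L k) = insert x (L l) := hkl
        rw [← Finset.erase_insert (hxL k), hkl, Finset.erase_insert (hxL l)]
      · exact hxD i (hik ▸ Finset.mem_insert_self x (L k))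
    · have hLk : L k ∈ (Δ.link x hx).faces :=
        ((isFacet_link_iff hx).mpr ((hLfacet (L k)).mpr ⟨k, rfl⟩)).1
      obtain ⟨E, hE, hLE⟩ := hdel.exists_isFacet_superset (A := L k) ⟨hLk.1, hLk.2.1⟩
      obtain ⟨j, rfl⟩ := (hDfacet E).mp ((isFacet_deletion_iff hshed).mp hE)
      exact ⟨j, hLE⟩

end Shelling

section Restriction

theorem mem_faces_generate_range {ι : Type*} [Nonempty ι] {F : ι → Finset V} {A : Finset V} :
    A ∈ (generate (Set.range F)).faces ↔ ∃ i, A ⊆ F i := by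
  refine ⟨?_, fun ⟨i, hi⟩ => .inr ⟨F i, ⟨i, rfl⟩, hi⟩⟩
  rintro (rfl | ⟨_, ⟨i, rfl⟩, hi⟩)
  exacts [⟨Classical.arbitrary ι, Finset.empty_subset _⟩, ⟨i, hi⟩]

variable [DecidableEq V]

/-- The set `ℛ(F k)` of a shelling: the elements of `F k` whose removal gives the intersection with
an earlier set. It is the least new face contributed by `F k`. -/
def restriction {t : ℕ} (F : Fin t → Finset V) (i : Fin t) : Finset V :=
  {x ∈ F i | ∃ j < i, F j ∩ F i = (F i).erase x}

theorem exists_subset_of_not_restriction_subset {t : ℕ} {F : Fin t → Finset V} {i : Fin t}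
    {A : Finset V} (hA : A ⊆ F i) (h : ¬ restriction F i ⊆ A) : ∃ j < i, A ⊆ F j := by
  obtain ⟨x, hx, hxA⟩ := Finset.not_subset.mp h
  obtain ⟨-, j, hj, hjx⟩ := Finset.mem_filter.mp hx
  exact ⟨j, hj, (hjx ▸ Finset.subset_erase.mpr ⟨hA, hxA⟩).trans Finset.inter_subset_left⟩

theorem IsShelling.not_restriction_subset {t : ℕ} {F : Fin t → Finset V} (hF : IsShelling F)
    {i j : Fin t} (hj : j < i) : ¬ restriction F i ⊆ F j := by
  obtain ⟨l, hl, x, hx, hxj, hlx⟩ := isShelling_iff.mp hF j i hj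
  exact fun h => hxj (h (Finset.mem_filter.mpr ⟨hx, l, hl, hlx⟩))

theorem IsShelling.castSucc {t : ℕ} {F : Fin (t + 1) → Finset V} (hF : IsShelling F) :
    IsShelling (F ∘ Fin.castSucc) := by
  intro i k hik
  obtain ⟨j, hj, h⟩ := hF i.castSucc k.castSucc hik
  exact ⟨j.castPred (hj.trans k.castSucc_lt_last).ne, hj, h⟩

variable {t : ℕ} {F : Fin (t + 2) → Finset V}

theorem IsShelling.mem_generate_castSucc_iff (hF : IsShelling F) (A : Finset V) :
    A ∈ (generate (Set.range (F ∘ Fin.castSucc))).faces ↔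
      A ∈ (generate (Set.range F)).faces ∧ ¬ restriction F (Fin.last (t + 1)) ⊆ A := by
  simp only [mem_faces_generate_range, Function.comp_apply]
  constructor
  · rintro ⟨i, hi⟩
    exact ⟨⟨i.castSucc, hi⟩, fun h => hF.not_restriction_subset i.castSucc_lt_last (h.trans hi)⟩
  · rintro ⟨⟨i, hi⟩, h⟩
    induction i using Fin.lastCases with
    | cast i => exact ⟨i, hi⟩
    | last =>
      obtain ⟨j, hj, hAj⟩ := exists_subset_of_not_restriction_subset hi h
      exact ⟨j.castPred hj.ne, hAj⟩

theorem IsShelling.restriction_last_union_mem_iff (hF : IsShelling F) (A : Finset V) :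
    restriction F (Fin.last (t + 1)) ∪ A ∈ (generate (Set.range F)).faces ↔
      A ∈ (simplex (F (Fin.last (t + 1)))).faces := by
  simp only [mem_faces_generate_range, mem_faces_simplex, Finset.union_subset_iff]
  constructor
  · rintro ⟨i, hR, hA⟩
    induction i using Fin.lastCases with
    | cast i => exact absurd hR (hF.not_restriction_subset i.castSucc_lt_last)
    | last => exact hA
  · exact fun hA => ⟨Fin.last (t + 1), Finset.filter_subset _ _, hA⟩

end Restriction

section StanleyReisnerIdeal

open MvPolynomial Ideal

variable {k : Type*} [Field k]

theorem sum_single_one_le_iff {F : Finset V} {u : V →₀ ℕ} :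
    ∑ v ∈ F, Finsupp.single v 1 ≤ u ↔ F ⊆ u.support := by
  classical
  simp only [Finsupp.le_def, Finsupp.finsetSum_apply, Finsupp.single_apply, Finset.sum_ite_eq',
    Finset.subset_iff, Finsupp.mem_support_iff]
  refine forall_congr' fun v => ?_
  split_ifs with hv <;> simp [hv, Nat.one_le_iff_ne_zero]

theorem support_prod_X_mul (F : Finset V) (p : MvPolynomial V k) :
    ((∏ v ∈ F, X v) * p).support =
      p.support.map (addLeftEmbedding (∑ v ∈ F, Finsupp.single v 1)) := by
  simp only [X, ← monomial_sum_one]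
  exact AddMonoidAlgebra.support_coeff_single_mul p _ (by simp) _

theorem mem_stanleyReisnerIdeal {Δ : FaceComplex V} {p : MvPolynomial V k} :
    p ∈ Δ.stanleyReisnerIdeal k ↔ ∀ u ∈ p.support, u.support ∉ Δ.faces := by
  have hgen : {m : MvPolynomial V k | ∃ F : Finset V, F ∉ Δ.faces ∧ m = ∏ v ∈ F, X v} =
      (fun u => monomial u 1) ''
        ((fun F : Finset V => ∑ v ∈ F, Finsupp.single v 1) '' {F | F ∉ Δ.faces}) := by
    ext m
    simp only [Set.mem_image, Set.mem_ofPred_eq, exists_exists_and_eq_and, monomial_sum_one, X,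
      eq_comm (a := m)]
  rw [stanleyReisnerIdeal, hgen, mem_ideal_span_monomial_image]
  refine forall₂_congr fun u _ => ?_
  simp only [Set.exists_mem_image, Set.mem_ofPred_eq, sum_single_one_le_iff]
  exact ⟨fun ⟨F, hF, hFu⟩ hu => hF (Δ.down_closed hu hFu), fun hu => ⟨_, hu, subset_rfl⟩⟩

theorem prod_X_mem_stanleyReisnerIdeal {Δ : FaceComplex V} {F : Finset V} (hF : F ∉ Δ.faces) :
    ∏ v ∈ F, X v ∈ Δ.stanleyReisnerIdeal k :=
  subset_span ⟨F, hF, rfl⟩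

theorem stanleyReisnerIdeal_simplex (F : Finset V) :
    (simplex F).stanleyReisnerIdeal k = span (X '' (F : Set V)ᶜ) := by
  ext p
  rw [mem_stanleyReisnerIdeal, mem_ideal_span_X_image]
  refine forall₂_congr fun u _ => ?_
  simp [mem_faces_simplex, Finset.not_subset, and_comm]

theorem stanleyReisnerIdeal_sup_span_prod_X {Γ Δ : FaceComplex V} {R : Finset V}
    (h : ∀ A, A ∈ Γ.faces ↔ A ∈ Δ.faces ∧ ¬ R ⊆ A) :
    Δ.stanleyReisnerIdeal k ⊔ span {∏ v ∈ R, X v} = Γ.stanleyReisnerIdeal k := by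
  apply le_antisymm
  · refine sup_le (span_le.mpr ?_) ((span_singleton_le_iff_mem _).mpr ?_)
    · rintro _ ⟨F, hF, rfl⟩
      exact prod_X_mem_stanleyReisnerIdeal fun hF' => hF ((h F).mp hF').1
    · exact prod_X_mem_stanleyReisnerIdeal fun hR => ((h R).mp hR).2 subset_rfl
  · refine span_le.mpr ?_
    rintro _ ⟨F, hF, rfl⟩
    by_cases hRF : R ⊆ F
    · exact mem_sup_right (mem_span_singleton.mpr (Finset.prod_dvd_prod_of_subset R F X hRF))
    · exact mem_sup_left (prod_X_mem_stanleyReisnerIdeal fun hF' => hF ((h F).mpr ⟨hF', hRF⟩))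

theorem prod_X_mul_mem_stanleyReisnerIdeal_iff [DecidableEq V] {Γ Δ : FaceComplex V}
    {R : Finset V} (h : ∀ A, R ∪ A ∈ Δ.faces ↔ A ∈ Γ.faces) {p : MvPolynomial V k} :
    (∏ v ∈ R, X v) * p ∈ Δ.stanleyReisnerIdeal k ↔ p ∈ Γ.stanleyReisnerIdeal k := by
  rw [mem_stanleyReisnerIdeal, mem_stanleyReisnerIdeal, support_prod_X_mul, Finset.forall_mem_map]
  refine forall₂_congr fun u _ => ?_
  have hsupport : (∑ v ∈ R, Finsupp.single v 1 + u).support = R ∪ u.support := by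
    ext v
    by_cases hv : v ∈ R <;> simp [Finsupp.single_apply, hv]
  rw [addLeftEmbedding_apply, hsupport, h]

theorem isSMulRegular_X_of_mem {F : Finset V} {x : V} (hx : x ∈ F) :
    IsSMulRegular ((simplex F).StanleyReisnerRing k) (X x : MvPolynomial V k) := by
  classical
  rw [isSMulRegular_quotient_iff_mem_of_smul_mem]
  intro p hp
  rw [smul_eq_mul, ← Finset.prod_singleton X x] at hp
  refine (prod_X_mul_mem_stanleyReisnerIdeal_iff fun A => ?_).mp hp
  simp only [mem_faces_simplex, Finset.union_subset_iff, Finset.singleton_subset_iff, hx, true_and]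

end StanleyReisnerIdeal

section ElementarySymmetric

open MvPolynomial Ideal RingTheory.Sequence

variable {k : Type*} [Field k]

theorem isWeaklyRegular_esymm_simplex (F : Finset V) :
    IsWeaklyRegular ((simplex F).StanleyReisnerRing k)
      (descending (F.val.map (X : V → MvPolynomial V k)).esymm F.card) := by
  classical
  refine isWeaklyRegular_quotient_esymm fun A _ x hx => ?_
  have hsup : (simplex F).stanleyReisnerIdeal k ⊔ span (X '' (A : Set V)) =
      (simplex (F \ A)).stanleyReisnerIdeal k := by
    rw [stanleyReisnerIdeal_simplex, stanleyReisnerIdeal_simplex, ← span_union, ← Set.image_union]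
    simp [Set.sdiff_eq, Set.compl_inter]
  rw [hsup]
  exact isSMulRegular_X_of_mem hx

variable [Fintype V]

theorem multiset_esymm_sub_esymm_mem (F : Finset V) (i : ℕ) :
    (F.val.map X).esymm i - esymm V k i ∈ (simplex F).stanleyReisnerIdeal k := by
  classical
  rw [Finset.esymm_map_val, esymm,
    ← Finset.sum_sdiff (Finset.powersetCard_mono (n := i) F.subset_univ), sub_add_cancel_right]
  refine neg_mem (sum_mem fun A hA => prod_X_mem_stanleyReisnerIdeal ?_)
  rw [mem_faces_simplex]
  grind

theorem IsShelling.isWeaklyRegular_esymm [DecidableEq V] {t m : ℕ} {F : Fin (t + 1) → Finset V}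
    (hF : IsShelling F) (hcard : ∀ i, (F i).card = m) :
    IsWeaklyRegular ((generate (Set.range F)).StanleyReisnerRing k) (descending (esymm V k) m) := by
  have hsimplex (i : Fin (t + 1)) :
      IsWeaklyRegular ((simplex (F i)).StanleyReisnerRing k) (descending (esymm V k) m) := by
    refine isWeaklyRegular_quotient_congr ?_ (hcard i ▸ isWeaklyRegular_esymm_simplex (F i))
    exact forall₂_descending fun j _ => multiset_esymm_sub_esymm_mem (F i) (j + 1)
  induction t with
  | zero =>
    have hgen : generate (Set.range F) = simplex (F 0) := by
      ext A
      rw [mem_faces_generate_range, mem_faces_simplex, Fin.exists_fin_one]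
    exact hgen ▸ hsimplex 0
  | succ t ih =>
    refine isWeaklyRegular_quotient_of_colon (x := ∏ v ∈ restriction F (Fin.last (t + 1)), X v)
      (fun p => prod_X_mul_mem_stanleyReisnerIdeal_iff hF.restriction_last_union_mem_iff)
      (hsimplex (Fin.last (t + 1))) ?_
    rw [stanleyReisnerIdeal_sup_span_prod_X hF.mem_generate_castSucc_iff]
    exact ih hF.castSucc (fun i => hcard i.castSucc) fun i => hsimplex i.castSucc

end ElementarySymmetric

section CohenMacaulay

open MvPolynomial Ideal RingTheory.Sequence

variable {k : Type*} [Field k]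

theorem irrelevantIdeal_ne_top (Δ : FaceComplex V) : Δ.irrelevantIdeal k ≠ ⊤ := by
  have hle : Δ.stanleyReisnerIdeal k ≤ RingHom.ker (constantCoeff (σ := V) (R := k)) := by
    refine span_le.mpr ?_
    rintro _ ⟨F, hF, rfl⟩
    have hne : F ≠ ∅ := fun h => hF (h ▸ Δ.empty_mem)
    simp [RingHom.mem_ker, map_prod, Finset.prod_const, hne]
  let augmentation := Ideal.Quotient.lift (Δ.stanleyReisnerIdeal k) constantCoeff hle
  have hker : Δ.irrelevantIdeal k ≤ RingHom.ker augmentation := by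
    refine span_le.mpr ?_
    rintro _ ⟨v, rfl⟩
    exact (Ideal.Quotient.lift_mk _ _ _).trans (constantCoeff_X k v)
  exact fun h => RingHom.ker_ne_top augmentation (top_le_iff.mp (h ▸ hker))

theorem depth_le_ringKrullDim [Finite V] (Δ : FaceComplex V) :
    (Δ.depth k : WithBot ℕ∞) ≤ ringKrullDim (Δ.StanleyReisnerRing k) := by
  have : Nontrivial (Δ.StanleyReisnerRing k) :=
    nontrivial_of_ne 0 1 fun h => irrelevantIdeal_ne_top Δ
      ((eq_top_iff_one _).mpr (h ▸ Ideal.zero_mem (Δ.irrelevantIdeal k)))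
  rw [← Module.supportDim_self_eq_ringKrullDim]
  obtain ⟨d, hd⟩ := WithBot.ne_bot_iff_exists.mp
    (Module.supportDim_ne_bot_of_nontrivial (Δ.StanleyReisnerRing k) (Δ.StanleyReisnerRing k))
  rw [← hd, WithBot.coe_le_coe]
  refine iSup₂_le fun rs hrs => WithBot.coe_le_coe.mp ?_
  rw [hd]
  exact length_le_supportDim_of_isRegular hrs.2

theorem length_le_depth {Δ : FaceComplex V} {rs : List (Δ.StanleyReisnerRing k)}
    (hmem : ∀ r ∈ rs, r ∈ Δ.irrelevantIdeal k)
    (hrs : IsWeaklyRegular (Δ.StanleyReisnerRing k) rs) : (rs.length : ℕ∞) ≤ Δ.depth k := by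
  refine le_iSup₂_of_le rs ⟨hmem, hrs, fun htop => irrelevantIdeal_ne_top (k := k) Δ ?_⟩ le_rfl
  rw [smul_eq_mul, mul_top] at htop
  exact top_le_iff.mp (htop ▸ span_le.mpr hmem)

theorem mk_esymm_succ_mem_irrelevantIdeal [Fintype V] (Δ : FaceComplex V) (i : ℕ) :
    Ideal.Quotient.mk (Δ.stanleyReisnerIdeal k) (esymm V k (i + 1)) ∈ Δ.irrelevantIdeal k := by
  rw [esymm, map_sum]
  refine sum_mem fun A hA => ?_
  obtain ⟨v, hv⟩ : A.Nonempty := Finset.card_pos.mp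
    ((Finset.mem_powersetCard.mp hA).2 ▸ i.succ_pos)
  rw [map_prod]
  exact mem_of_dvd _ (Finset.dvd_prod_of_mem _ hv) (subset_span ⟨v, rfl⟩)

theorem ringKrullDim_stanleyReisnerRing_simplex_le (F : Finset V) :
    ringKrullDim ((simplex F).StanleyReisnerRing k) ≤ F.card := by
  let f : MvPolynomial F k →ₐ[k] (simplex F).StanleyReisnerRing k :=
    aeval fun v => Ideal.Quotient.mk _ (X v.1)
  have hX (v : V) : Ideal.Quotient.mkₐ k ((simplex F).stanleyReisnerIdeal k) (X v) ∈ f.range := by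
    by_cases hv : v ∈ F
    · exact ⟨X ⟨v, hv⟩, aeval_X _ _⟩
    · have hzero : X v ∈ (simplex F).stanleyReisnerIdeal k :=
        stanleyReisnerIdeal_simplex (k := k) F ▸ subset_span ⟨v, hv, rfl⟩
      exact (Ideal.Quotient.eq_zero_iff_mem.mpr hzero).symm ▸ zero_mem f.range
  have hf : Function.Surjective f := by
    rw [← AlgHom.range_eq_top, eq_top_iff]
    rw [← (AlgHom.range_eq_top _).mpr (Ideal.Quotient.mkₐ_surjective k _), ← Algebra.map_top,
      ← adjoin_range_X, AlgHom.map_adjoin, Algebra.adjoin_le_iff]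
    rintro _ ⟨_, ⟨v, rfl⟩, rfl⟩
    exact hX v
  calc ringKrullDim ((simplex F).StanleyReisnerRing k) ≤ ringKrullDim (MvPolynomial F k) :=
        ringKrullDim_le_of_surjective f.toRingHom hf
    _ = F.card := by
        rw [MvPolynomial.ringKrullDim_of_isNoetherianRing, ringKrullDim_eq_zero_of_field, zero_add]
        simp

theorem ringKrullDim_stanleyReisnerRing_le [Finite V] {Δ : FaceComplex V} {m : ℕ}
    (hcard : ∀ F ∈ Δ.faces, F.card ≤ m) : ringKrullDim (Δ.StanleyReisnerRing k) ≤ m := by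
  classical
  cases nonempty_fintype V
  refine ringKrullDim_quotient_le_of_forall_isPrime fun P hP hΔP => ?_
  let F : Finset V := {v | (X v : MvPolynomial V k) ∉ P}
  have hF : F ∈ Δ.faces := by
    by_contra hF
    obtain ⟨v, hv, hvP⟩ := hP.prod_mem_iff.mp (hΔP (prod_X_mem_stanleyReisnerIdeal hF))
    exact (Finset.mem_filter.mp hv).2 hvP
  refine ⟨(simplex F).stanleyReisnerIdeal k, ?_,
    (ringKrullDim_stanleyReisnerRing_simplex_le F).trans (by exact_mod_cast hcard F hF)⟩
  rw [stanleyReisnerIdeal_simplex, span_le]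
  rintro _ ⟨v, hv, rfl⟩
  simpa [F] using hv

theorem le_depth_generate [Finite V] [DecidableEq V] {t m : ℕ} {F : Fin (t + 1) → Finset V}
    (hF : IsShelling F) (hcard : ∀ i, (F i).card = m) :
    (m : ℕ∞) ≤ (generate (Set.range F)).depth k := by
  cases nonempty_fintype V
  set Δ := generate (Set.range F)
  have hweak := (isWeaklyRegular_map_algebraMap_iff (Δ.StanleyReisnerRing k)
    (Δ.StanleyReisnerRing k) _).mpr (hF.isWeaklyRegular_esymm (k := k) hcard)
  have hdepth := length_le_depth (fun r hr => ?_) hweak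
  · rwa [List.length_map, length_descending] at hdepth
  · obtain ⟨e, he, rfl⟩ := List.mem_map.mp hr
    obtain ⟨i, -, rfl⟩ := mem_descending.mp he
    exact mk_esymm_succ_mem_irrelevantIdeal Δ i

theorem IsShellable.isCohenMacaulay [Finite V] [DecidableEq V] {Δ : FaceComplex V}
    (hpure : Δ.IsPure) (hshell : Δ.IsShellable) : Δ.IsCohenMacaulay k := by
  obtain ⟨t, F, -, hfacet, hF⟩ := hshell
  have hsuperset {A : Finset V} (hA : A ∈ Δ.faces) : ∃ i, A ⊆ F i := by
    obtain ⟨B, hAB, hB⟩ := (Set.toFinite Δ.faces).exists_le_maximal hA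
    obtain ⟨i, rfl⟩ := (hfacet B).mp hB
    exact ⟨i, hAB⟩
  obtain ⟨i₀, -⟩ := hsuperset Δ.empty_mem
  obtain ⟨t, rfl⟩ := Nat.exists_eq_succ_of_ne_zero i₀.pos.ne'
  have hface (i) : Δ.IsFacet (F i) := (hfacet _).mpr ⟨i, rfl⟩
  have hcard (i) : (F i).card = (F i₀).card := hpure (hface i) (hface i₀)
  have hgen : Δ = generate (Set.range F) := by
    ext A
    rw [mem_faces_generate_range]
    exact ⟨hsuperset, fun ⟨i, hi⟩ => Δ.down_closed (hface i).1 hi⟩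
  refine le_antisymm (depth_le_ringKrullDim Δ) ?_
  calc ringKrullDim (Δ.StanleyReisnerRing k) ≤ (F i₀).card :=
        ringKrullDim_stanleyReisnerRing_le fun A hA =>
          (hsuperset hA).elim fun i hi => hcard i ▸ Finset.card_le_card hi
    _ ≤ Δ.depth k := by
        rw [hgen]
        exact WithBot.coe_le_coe.mpr (le_depth_generate hF hcard)

end CohenMacaulay

section CliqueComplexes

/-- The clique complex of the subgraph of `H` induced on `U`, as a complex over all of `V`. -/
def cliquesWithin (H : SimpleGraph V) (U : Finset V) : FaceComplex V where
  faces := {F | F ⊆ U ∧ H.IsClique (F : Set V)}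
  empty_mem := by simp
  down_closed := fun _ _ hF hG =>
    ⟨hG.trans hF.1, hF.2.subset (Finset.coe_subset.mpr hG)⟩

theorem mem_faces_cliquesWithin {H : SimpleGraph V} {U F : Finset V} :
    F ∈ (cliquesWithin H U).faces ↔ F ⊆ U ∧ H.IsClique (F : Set V) :=
  Iff.rfl

theorem cliquesWithin_univ [Fintype V] (H : SimpleGraph V) :
    cliquesWithin H Finset.univ = cliqueComplex H := by
  ext F
  simp [cliquesWithin, cliqueComplex]

theorem cliquesWithin_eq_simplex {H : SimpleGraph V} {U : Finset V}
    (hU : H.IsClique (U : Set V)) : cliquesWithin H U = simplex U := by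
  ext F
  exact ⟨And.left, fun hF => ⟨hF, hU.subset (Finset.coe_subset.mpr hF)⟩⟩

variable [DecidableEq V]

theorem deletion_cliquesWithin (H : SimpleGraph V) (U : Finset V) (x : V) :
    (cliquesWithin H U).deletion x = cliquesWithin H (U.erase x) := by
  ext F
  simp only [deletion, cliquesWithin, Set.mem_ofPred_eq, Finset.subset_erase]
  tauto

variable {H : SimpleGraph V} {U : Finset V}

theorem insert_mem_faces_cliquesWithin {F : Finset V} {y : V} (hy : y ∈ U)
    (hF : F ∈ (cliquesWithin H U).faces) (hadj : ∀ v ∈ F, H.Adj y v) :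
    insert y F ∈ (cliquesWithin H U).faces := by
  refine ⟨Finset.insert_subset hy hF.1, ?_⟩
  rw [Finset.coe_insert, SimpleGraph.isClique_insert]
  exact ⟨hF.2, fun v hv _ => hadj v hv⟩

variable [DecidableRel H.Adj]

theorem link_cliquesWithin {x : V} (hx : {x} ∈ (cliquesWithin H U).faces) :
    (cliquesWithin H U).link x hx = cliquesWithin H (U.filter (H.Adj x)) := by
  ext F
  constructor
  · rintro ⟨hF, hxF, -, hinsert⟩
    refine ⟨fun v hv => Finset.mem_filter.mpr ⟨hF.1 hv, ?_⟩, hF.2⟩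
    exact hinsert (by simp) (by simp [hv]) (ne_of_mem_of_not_mem hv hxF).symm
  · rintro ⟨hFU, hF⟩
    have hadj v (hv : v ∈ F) : H.Adj x v := (Finset.mem_filter.mp (hFU hv)).2
    have hF : F ∈ (cliquesWithin H U).faces := ⟨hFU.trans (Finset.filter_subset _ _), hF⟩
    exact ⟨hF, fun hxF => (hadj x hxF).ne rfl,
      insert_mem_faces_cliquesWithin (Finset.singleton_subset_iff.mp hx.1) hF hadj⟩

theorem isVertexDecomposable_cliquesWithin_of_dominated {x y : V} (hx : x ∈ U) (hy : y ∈ U)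
    (hyx : y ≠ x) (hnadj : ¬ H.Adj x y) (hdom : ∀ z ∈ U, H.Adj x z → H.Adj y z)
    (hdel : (cliquesWithin H (U.erase x)).IsVertexDecomposable)
    (hlink : (cliquesWithin H (U.filter (H.Adj x))).IsVertexDecomposable) :
    (cliquesWithin H U).IsVertexDecomposable := by
  have hx' : {x} ∈ (cliquesWithin H U).faces := by simp [mem_faces_cliquesWithin, hx]
  refine .shed _ x hx' (deletion_cliquesWithin H U x ▸ hdel) (link_cliquesWithin hx' ▸ hlink)
    fun F hF => ?_
  have hadj v (hv : v ∈ F) : H.Adj x v := by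
    rw [link_cliquesWithin hx'] at hF
    exact (Finset.mem_filter.mp (hF.1.1 hv)).2
  refine not_isFacet_of_insert_mem (y := y) (fun hyF => hnadj (hadj y hyF)) ?_
  have hFdel : F ∈ ((cliquesWithin H U).deletion x).faces := ⟨hF.1.1, hF.1.2.1⟩
  rw [deletion_cliquesWithin] at hFdel ⊢
  exact insert_mem_faces_cliquesWithin (Finset.mem_erase.mpr ⟨hyx, hy⟩) hFdel
    fun v hv => hdom v (hF.1.1.1 hv) (hadj v hv)

theorem isVertexDecomposable_cliquesWithin (P : Finset V → Prop)
    (hP : ∀ U, P U → H.IsClique (U : Set V) ∨ ∃ x ∈ U, ∃ y ∈ U, y ≠ x ∧ ¬ H.Adj x y ∧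
      (∀ z ∈ U, H.Adj x z → H.Adj y z) ∧ P (U.erase x) ∧ P (U.filter (H.Adj x)))
    (hU : P U) : (cliquesWithin H U).IsVertexDecomposable := by
  induction U using Finset.strongInduction with
  | H U ih =>
    obtain hclique | ⟨x, hx, y, hy, hyx, hnadj, hdom, hdel, hlink⟩ := hP U hU
    · rw [cliquesWithin_eq_simplex hclique]
      exact .simplex U
    · exact isVertexDecomposable_cliquesWithin_of_dominated hx hy hyx hnadj hdom
        (ih _ (Finset.erase_ssubset hx) hdel)
        (ih _ (Finset.filter_ssubset.mpr ⟨x, hx, H.loopless.irrefl x⟩) hlink)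

end CliqueComplexes

end FaceComplex

section BooleanGraph

open FaceComplex

variable {n : ℕ}

theorem booleanGraph_adj {A B : BooleanVertex n} :
    (booleanGraph n).Adj A B ↔ Disjoint A.1 B.1 :=
  Finset.disjoint_iff_inter_eq_empty.symm

theorem booleanGraph_compl_adj {A B : BooleanVertex n} :
    (booleanGraph n)ᶜ.Adj A B ↔ A ≠ B ∧ ¬ Disjoint A.1 B.1 := by
  rw [SimpleGraph.compl_adj, booleanGraph_adj]

/-- The class of vertex sets over which the clique complex of the Boolean graph is decomposed: with
a set `A` they contain the singletons of all elements of `A`. -/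
def ContainsSingletons (U : Finset (BooleanVertex n)) : Prop :=
  ∀ A ∈ U, ∀ i ∈ A.1, ∃ B ∈ U, B.1 = {i}

theorem containsSingletons_univ : ContainsSingletons (Finset.univ : Finset (BooleanVertex n)) := by
  refine fun A _ i hi => ⟨⟨{i}, Finset.singleton_ne_empty i, fun h => A.2.2 ?_⟩,
    Finset.mem_univ _, rfl⟩
  exact Finset.univ_subset_iff.mp (h.symm.subset.trans (Finset.singleton_subset_iff.mpr hi))

theorem ContainsSingletons.erase {U : Finset (BooleanVertex n)} (hU : ContainsSingletons U)
    {A : BooleanVertex n} (hA : 1 < A.1.card) : ContainsSingletons (U.erase A) := by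
  intro C hC i hi
  obtain ⟨B, hB, hBi⟩ := hU C (Finset.mem_of_mem_erase hC) i hi
  refine ⟨B, Finset.mem_erase.mpr ⟨?_, hB⟩, hBi⟩
  rintro rfl
  simp [hBi] at hA

theorem ContainsSingletons.filter_adj {U : Finset (BooleanVertex n)}
    (hU : ContainsSingletons U) (A : BooleanVertex n) [DecidablePred ((booleanGraph n).Adj A)] :
    ContainsSingletons (U.filter ((booleanGraph n).Adj A)) := by
  intro C hC i hi
  obtain ⟨hCU, hAC⟩ := Finset.mem_filter.mp hC
  obtain ⟨B, hB, hBi⟩ := hU C hCU i hi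
  refine ⟨B, Finset.mem_filter.mpr ⟨hB, booleanGraph_adj.mpr ?_⟩, hBi⟩
  rw [hBi]
  exact (booleanGraph_adj.mp hAC).mono_right (Finset.singleton_subset_iff.mpr hi)

theorem isClique_booleanGraph_of_card_le_one {U : Set (BooleanVertex n)}
    (hU : ∀ A ∈ U, A.1.card ≤ 1) : (booleanGraph n).IsClique U := by
  intro A hA B hB hAB
  rw [booleanGraph_adj]
  have hcard {C} (hC : C ∈ U) : C.1.card = 1 :=
    (hU C hC).antisymm (Finset.one_le_card.mpr (Finset.nonempty_iff_ne_empty.mpr C.2.1))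
  obtain ⟨i, hi⟩ := Finset.card_eq_one.mp (hcard hA)
  obtain ⟨j, hj⟩ := Finset.card_eq_one.mp (hcard hB)
  rw [hi, hj, Finset.disjoint_singleton]
  rintro rfl
  exact hAB (Subtype.ext (hi.trans hj.symm))

theorem isVertexDecomposable_cliqueComplex_booleanGraph (n : ℕ) :
    (cliqueComplex (booleanGraph n)).IsVertexDecomposable := by
  classical
  rw [← cliquesWithin_univ]
  refine isVertexDecomposable_cliquesWithin ContainsSingletons (fun U hU => ?_)
    containsSingletons_univ
  by_cases hcard : ∀ A ∈ U, A.1.card ≤ 1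
  · exact .inl (isClique_booleanGraph_of_card_le_one hcard)
  right
  push Not at hcard
  obtain ⟨A, hA, hcard⟩ := hcard
  obtain ⟨i, hi⟩ := Finset.nonempty_iff_ne_empty.mpr A.2.1
  obtain ⟨B, hB, hBi⟩ := hU A hA i hi
  refine ⟨A, hA, B, hB, ?_, ?_, fun C _ hAC => ?_, hU.erase hcard, hU.filter_adj A⟩
  · rintro rfl
    simp [hBi] at hcard
  · simpa [booleanGraph_adj, hBi] using hi
  · rw [booleanGraph_adj, hBi]
    exact (booleanGraph_adj.mp hAC).mono_left (Finset.singleton_subset_iff.mpr hi)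

theorem isUpperSet_filter_booleanGraph_compl_adj {U : Finset (BooleanVertex n)}
    (hU : IsUpperSet (U : Set (BooleanVertex n))) {M : BooleanVertex n} (hM : Minimal (· ∈ U) M)
    [DecidablePred ((booleanGraph n)ᶜ.Adj M)] :
    IsUpperSet (U.filter ((booleanGraph n)ᶜ.Adj M) : Set (BooleanVertex n)) := by
  intro C D hCD hC
  simp only [Finset.coe_filter, Set.mem_ofPred_eq, booleanGraph_compl_adj] at hC ⊢
  obtain ⟨hCU, hMC, hdisj⟩ := hC
  refine ⟨hU hCD hCU, ?_, fun h => hdisj (h.mono_right hCD)⟩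
  rintro rfl
  exact hMC (hM.eq_of_ge hCU hCD)

theorem isVertexDecomposable_cliqueComplex_booleanGraph_compl (n : ℕ) :
    (cliqueComplex (booleanGraph n)ᶜ).IsVertexDecomposable := by
  classical
  rw [← cliquesWithin_univ]
  refine isVertexDecomposable_cliquesWithin
    (fun U => IsUpperSet (U : Set (BooleanVertex n))) (fun U hU => ?_) (by simp [isUpperSet_univ])
  by_cases hmeet : ∀ A ∈ U, ∀ B ∈ U, ¬ Disjoint A.1 B.1
  · exact .inl fun A hA B hB hAB => booleanGraph_compl_adj.mpr ⟨hAB, hmeet A hA B hB⟩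
  right
  push Not at hmeet
  obtain ⟨A, hA, B, hB, hAB⟩ := hmeet
  obtain ⟨M, hMA, hM⟩ := U.exists_le_minimal hA
  let N : BooleanVertex n := ⟨M.1ᶜ, by simpa using M.2.2, by simpa using M.2.1⟩
  have hMN : Disjoint M.1 N.1 := disjoint_compl_right
  have hNU : N ∈ U :=
    hU (show B ≤ N from le_compl_iff_disjoint_left.mpr (hAB.mono_left hMA)) hB
  refine ⟨M, hM.1, N, hNU, ?_, ?_, fun C hC hMC => ?_, ?_,
    isUpperSet_filter_booleanGraph_compl_adj hU hM⟩
  · intro h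
    exact M.2.1 (disjoint_self.mp (h ▸ hMN))
  · exact fun h => (booleanGraph_compl_adj.mp h).2 hMN
  · rw [booleanGraph_compl_adj] at hMC ⊢
    refine ⟨?_, fun h => hMC.1 (hM.eq_of_ge hC (disjoint_compl_left_iff.mp h))⟩
    rintro rfl
    exact hMC.2 hMN
  · rw [Finset.coe_erase]
    exact hU.erase fun C hC hCM => hM.eq_of_le hC hCM

end BooleanGraph

theorem mainTheorem4 (n : ℕ) (hn : 1 ≤ n) (G : SimpleGraph (BooleanVertex n))
    (hG : G = booleanGraph n ∨ G = (booleanGraph n)ᶜ) :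
    (∀ s : ℕ, ((cliqueComplex Gᶜ).skeleton s).IsVertexDecomposable) ∧
    (∀ s : ℕ, ((cliqueComplex Gᶜ).pureSkeleton s).IsPure ∧
      ((cliqueComplex Gᶜ).pureSkeleton s).IsShellable ∧
      ∀ (k : Type*) [Field k], ((cliqueComplex Gᶜ).pureSkeleton s).IsCohenMacaulay k) := by
  have hvd : (cliqueComplex Gᶜ).IsVertexDecomposable := by
    rcases hG with rfl | rfl
    · exact isVertexDecomposable_cliqueComplex_booleanGraph_compl n
    · rw [compl_compl]
      exact isVertexDecomposable_cliqueComplex_booleanGraph n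
  refine ⟨fun s => hvd.skeleton s, fun s => ?_⟩
  have hpure := (cliqueComplex Gᶜ).isPure_pureSkeleton s
  have hshell := (hvd.pureSkeleton s).isShellable
  exact ⟨hpure, hshell, fun k _ => hshell.isCohenMacaulay hpure⟩
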